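/- For a partition $\lambda=(\lambda_1\ge\lambda_2\ge\dots)$ let $f_\lambda$ be the number of standard Young tableaux of shape $\lambda$; write $\lambda\vdash n$ if $\lambda$ is a partition of $n$, regarded as $(\lambda_1,\dots,\lambda_n)$ by appending zeros. Let $e_\beta$ be the $\beta$-th elementary symmetric polynomial (so $e_\beta$ of $n$ numbers is $0$ if $\beta>n$), let $s_\lambda$ be the Schur polynomial, and let $c(k,j)$ be the unsigned Stirling numbers of the first kind. For $n\ge 0$ consider the formal power series in $y_1,\dots,y_n,w_1,\dots,w_n$ with coefficients in $\mathbb{Q}[u]$ $$G_n=\sum_{\lambda:\ \ell(\lambda)\le n}s_\lambda(y_1,\dots,y_n)\,s_\lambda(w_1,\dots,w_n)\prod_{i=1}^n(\lambda_i+n-i+u),$$ where $\lambda$ runs over all partitions with at most $n$ parts, and write $[\,\cdot\,]G_n$ for the coefficient of a monomial. Fix an integer $\beta\ge 0$. Then for every integer $n\ge\beta$ $$\frac1{n!}\,[y_1\cdots y_n\,w_1\cdots w_n\,u^{n-\beta}]\,G_n=\frac1{n!}\sum_{\lambda\vdash n}f_\lambda^2\,e_\beta(\{\lambda_i+n-i:1\le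 i\le n\})=\sum_{\alpha=n-\beta}^{n}c(\alpha,n-\beta)\binom n\alpha .$$ Moreover, there is a polynomial $P\in\mathbb{Q}[x]$ of degree exactly $2\beta$ such that, for every integer $n\ge 0$, $$\frac1{n!}\sum_{\lambda\vdash n}f_\lambda^2\,e_\beta(\{\lambda_i+n-i:1\le i\le n\})=P(n).$$ -/

import Mathlib

open Finset

namespace ShiftedParts

/-- The number `f_μ` of standard Young tableaux of shape `μ`: bijective fillings of the cells of `μ`
with `Fin μ.card` that increase along every row and down every column. -/
noncomputable def numSYT (μ : YoungDiagram) : ℕ :=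
  Nat.card {T : μ.cells ≃ Fin μ.card //
    (∀ c d : μ.cells, c.1.1 = d.1.1 → c.1.2 < d.1.2 → T c < T d) ∧
    (∀ c d : μ.cells, c.1.2 = d.1.2 → c.1.1 < d.1.1 → T c < T d)}

theorem finite_card_eq (n : ℕ) : {μ : YoungDiagram | μ.card = n}.Finite := by
  have hsub : ∀ μ : YoungDiagram, μ.card = n → μ.cells ⊆ range n ×ˢ range n := by
    rintro μ rfl ⟨i, j⟩ hc
    rw [mem_product, mem_range, mem_range]
    have hc' : (i, j) ∈ μ := hc
    constructor
    · have h1 := YoungDiagram.mem_iff_lt_colLen.1 hc'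
      have h2 : μ.colLen j ≤ μ.card := by
        rw [YoungDiagram.colLen_eq_card]
        exact card_le_card (filter_subset _ _)
      exact h1.trans_le h2
    · have h1 := YoungDiagram.mem_iff_lt_rowLen.1 hc'
      have h2 : μ.rowLen i ≤ μ.card := by
        rw [YoungDiagram.rowLen_eq_card]
        exact card_le_card (filter_subset _ _)
      exact h1.trans_le h2
  refine Set.Finite.of_finite_image (f := YoungDiagram.cells) ?_ ?_
  · refine ((range n ×ˢ range n).powerset.finite_toSet).subset ?_
    rintro _ ⟨μ, hμ, rfl⟩
    exact mem_coe.2 (mem_powerset.2 (hsub μ hμ))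
  · intro μ _ ν _ h
    exact YoungDiagram.ext h

/-- The finite set of all partitions of `n`, given as Young diagrams with `n` cells; the `i`-th part
(counted from `0`, and `0` beyond the length) of such a `μ` is `μ.rowLen i`. -/
noncomputable def partitionsOf (n : ℕ) : Finset YoungDiagram :=
  (finite_card_eq n).toFinset

/-- The shifted parts `λ_i + n - i`, `1 ≤ i ≤ n`; the index `i` here is one less. -/
def shiftedParts (n : ℕ) (μ : YoungDiagram) : Multiset ℕ :=
  (univ : Finset (Fin n)).val.map fun i => μ.rowLen i + (n - 1 - i)

/-- `(1 / n!) ∑_{λ ⊢ n} f_λ² e_β({λ_i + n - i : 1 ≤ i ≤ n})`. -/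
noncomputable def shiftedSum (n β : ℕ) : ℚ :=
  1 / (n.factorial : ℚ) *
    ∑ μ ∈ partitionsOf n, (numSYT μ : ℚ) ^ 2 * ((shiftedParts n μ).esymm β : ℚ)

open Classical in
/-- The Schur polynomial `s_μ` in `n` variables: the sum over the fillings of `μ` with entries in
`Fin n` that form a semistandard Young tableau, of the product of the variables of the entries. -/
noncomputable def schurPoly (R : Type*) [CommRing R] (n : ℕ) (μ : YoungDiagram) :
    MvPolynomial (Fin n) R :=
  ∑ T : μ.cells → Fin n with
      ∃ S : SemistandardYoungTableau μ, ∀ c : μ.cells, S c.1.1 c.1.2 = (T c : ℕ),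
    ∏ c : μ.cells, MvPolynomial.X (T c)

/-- `s_μ(y_1, …, y_n) s_μ(w_1, …, w_n) ∏_{i=1}^n (μ_i + n - i + u)`, where the variables `y` are
indexed by `Sum.inl`, the variables `w` by `Sum.inr`, and `u` is the variable of `ℚ[u]`. -/
noncomputable def schurTerm (n : ℕ) (μ : YoungDiagram) :
    MvPolynomial (Fin n ⊕ Fin n) (Polynomial ℚ) :=
  MvPolynomial.rename Sum.inl (schurPoly (Polynomial ℚ) n μ) *
    MvPolynomial.rename Sum.inr (schurPoly (Polynomial ℚ) n μ) *
    MvPolynomial.C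
      (((shiftedParts n μ).map fun a => (a : Polynomial ℚ) + Polynomial.X).prod)

/-- The formal power series
`G = ∑_λ s_λ(y_1, …, y_n) s_λ(w_1, …, w_n) ∏_{i=1}^n (λ_i + n - i + u)` in `y, w` with coefficients
in `ℚ[u]`, summed over all partitions with at most `n` parts. Each of its coefficients is a sum with
finitely many nonzero terms, see `finite_support_schurTerm`. -/
noncomputable def genSeries (n : ℕ) : MvPowerSeries (Fin n ⊕ Fin n) (Polynomial ℚ) :=
  fun d => ∑ᶠ (μ : YoungDiagram) (_ : μ.colLen 0 ≤ n), (schurTerm n μ).coeff d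

theorem schurPoly_isHomogeneous (R : Type*) [CommRing R] (n : ℕ) (μ : YoungDiagram) :
    (schurPoly R n μ).IsHomogeneous μ.card := by
  classical
  refine MvPolynomial.IsHomogeneous.sum _ _ _ fun T _ => ?_
  have h := MvPolynomial.IsHomogeneous.prod (univ : Finset μ.cells)
    (fun c => (MvPolynomial.X (T c) : MvPolynomial (Fin n) R)) (fun _ => 1)
    (fun c _ => MvPolynomial.isHomogeneous_X R (T c))
  simpa using h

theorem finite_support_schurTerm (n : ℕ) (d : Fin n ⊕ Fin n →₀ ℕ) :
    {μ : YoungDiagram | (schurTerm n μ).coeff d ≠ 0}.Finite := by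
  have hfin : {μ : YoungDiagram | μ.card ≤ d.degree}.Finite := by
    have : {μ : YoungDiagram | μ.card ≤ d.degree} =
        ⋃ k ∈ Set.Iic d.degree, {μ : YoungDiagram | μ.card = k} := by
      ext μ; simp
    rw [this]
    exact (Set.finite_Iic _).biUnion fun k _ => finite_card_eq k
  refine hfin.subset fun μ hμ => ?_
  have hs := schurPoly_isHomogeneous (Polynomial ℚ) n μ
  have h : (schurTerm n μ).IsHomogeneous (μ.card + μ.card + 0) :=
    (((hs.rename_isHomogeneous).mul (hs.rename_isHomogeneous)).mul
      (MvPolynomial.isHomogeneous_C _ _))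
  have h2 : d.degree = μ.card + μ.card + 0 := by
    by_contra hne
    exact hμ (h.coeff_eq_zero hne)
  change μ.card ≤ d.degree
  omega

/-- The coefficient `[y_1 ⋯ y_n w_1 ⋯ w_n u^k] G`. -/
noncomputable def genCoeff (n k : ℕ) : ℚ :=
  (MvPowerSeries.coeff (∑ v : Fin n ⊕ Fin n, Finsupp.single v 1) (genSeries n)).coeff k

end ShiftedParts

/-! Put T_n(u) = ∑_{λ ⊢ n} f_λ² ∏_i (u + λ_i + n - i), which is `totalPoly n`. Its coefficient of
u^(n-β) is n! times `shiftedSum n β`. It is also the coefficient of y_1⋯y_n w_1⋯w_n in G_n, because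
y_1⋯y_n has coefficient f_λ in s_λ if |λ| = n and 0 otherwise. Everything therefore rests on T_n =
n! ∑_α binom(n, α) u(u+1)⋯(u+α-1), whose coefficients are Stirling numbers.

This closed form follows by Pascal's rule from T_{n+1}(u) = (n+1)(u T_n(u+1) + T_n(u))
(`totalPoly_succ`). For the recurrence, write f_μ² = ∑_ν f_ν f_μ over the ν obtained by removing a
cell from μ, then fix ν and sum over μ. The ratios f_μ / f_ν are explicit by the formula of
Frobenius (`numSYT_eq_frobenius`), and the sum over μ is a Lagrange interpolation
(`sum_growth_weight`). The formula of Frobenius is itself proved from the branching rule by another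
interpolation (`sum_branching_weight`).

For polynomiality, c(m, m-k) is a nonnegative combination of the binom(m, s) with s ≤ 2k.
Substituting m = n - j, k = β - j gives terms of degree at most 2β - j in n, so degree 2β comes only
from j = 0, with a positive coefficient. -/

namespace ShiftedParts

/-! ### Two identities from Lagrange interpolation. -/

section Interpolation

open Polynomial

variable {ι : Type*} [DecidableEq ι]

/-- The polynomial form of the Plancherel growth process. -/
theorem sum_growth_weight (s : Finset ι) (v : ι → ℚ) (hv : Set.InjOn v s) (t : ι) (ht : t ∈ s)
    (ht0 : v t = 0) (hpos : ∀ i ∈ s, v i + 1 ≠ 0) :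
    ∑ i ∈ s, C ((∏ j ∈ s.erase i, (v i + 1 - v j) / (v i - v j)) / (v i + 1)) *
        ((X + C (v i + 1)) * ∏ j ∈ s.erase i, (X + C (v j))) =
      ∏ j ∈ s, (X + C (v j)) + ∏ j ∈ s.erase t, (X + C (v j - 1)) := by
  -- `Q` is monic of degree `#s - 1`, so it is interpolated at the `#s` nodes `-v i`. By `hw` the
  -- Lagrange coefficients are exactly the growth weights, because the factor missing at `t` is `-(v
  -- i + 1)`. Comparing leading coefficients shows that the weights sum to 1.
  set Q : ℚ[X] := ∏ j ∈ s.erase t, (X + C (v j - 1)) with hQ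
  have hQm : Q.Monic := monic_prod_of_monic _ _ fun j _ => monic_X_add_C _
  have hQn : Q.natDegree = #s - 1 := by
    rw [hQ, natDegree_prod_of_monic _ _ fun j _ => monic_X_add_C _]
    simp [card_erase_of_mem ht, -map_sub]
  have hs : 0 < #s := card_pos.2 ⟨t, ht⟩
  have hdeg : Q.degree < #s := by
    rw [degree_eq_natDegree hQm.ne_zero, hQn]
    exact_mod_cast Nat.sub_lt hs one_pos
  have hv' : Set.InjOn (fun i => -v i) s := fun a ha b hb h => hv ha hb (neg_injective h)
  have hw : ∀ i ∈ s, Q.eval (-v i) / ∏ j ∈ s.erase i, (-v i - -v j) =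
      (∏ j ∈ s.erase i, (v i + 1 - v j) / (v i - v j)) / (v i + 1) := by
    intro i hi
    have h1 : Q.eval (-v i) * (v i + 1) = ∏ j ∈ s.erase i, (v j - v i - 1) := by
      have h2 : Q.eval (-v i) = ∏ j ∈ s.erase t, (v j - v i - 1) := by
        rw [hQ, eval_prod]
        refine prod_congr rfl fun j _ => ?_
        simp only [eval_add, eval_X, eval_C]
        ring
      have h3 := mul_prod_erase s (fun j => v j - v i - 1) ht
      have h4 := mul_prod_erase s (fun j => v j - v i - 1) hi
      rw [h2]
      simp only [ht0] at h3
      simp only [sub_self] at h4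
      linarith
    rw [← eq_div_iff (hpos i hi)] at h1
    rw [h1, div_right_comm, ← prod_div_distrib]
    congr 1
    refine prod_congr rfl fun j hj => ?_
    rw [← neg_div_neg_eq]
    congr 1 <;> ring
  have hL := Lagrange.eq_interpolate hv' hdeg
  rw [Lagrange.interpolate_eq_sum] at hL
  have hone := Lagrange.coeff_eq_sum hv' hdeg
  rw [← hQn, hQm.coeff_natDegree, sum_congr rfl hw] at hone
  -- Split `X + v i + 1` as `(X + v i) + 1`: the first part completes the full product, the second
  -- is the interpolation formula for `Q`.
  have hsplit : ∀ i ∈ s, C ((∏ j ∈ s.erase i, (v i + 1 - v j) / (v i - v j)) / (v i + 1)) *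
        ((X + C (v i + 1)) * ∏ j ∈ s.erase i, (X + C (v j))) =
      C ((∏ j ∈ s.erase i, (v i + 1 - v j) / (v i - v j)) / (v i + 1)) * ∏ j ∈ s, (X + C (v j)) +
      C (Q.eval (-v i) / ∏ j ∈ s.erase i, (-v i - -v j)) *
        ∏ j ∈ s.erase i, (X - C (-v j)) := by
    intro i hi
    rw [hw i hi, ← mul_prod_erase s (fun j => X + C (v j)) hi]
    simp only [map_neg, sub_neg_eq_add, map_add, map_one]
    ring
  rw [sum_congr rfl hsplit, sum_add_distrib, ← hL, ← sum_mul, ← map_sum, ← hone, map_one, one_mul]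

/-- The factor `X ^ 2` shifts the top three coefficients to indices that need no truncated
subtraction, even if `s` has fewer than two elements. -/
theorem coeff_X_sq_mul_prod (s : Finset ι) (v : ι → ℚ) :
    (X ^ 2 * ∏ j ∈ s, (X - C (v j))).coeff (#s + 2) = 1 ∧
    (X ^ 2 * ∏ j ∈ s, (X - C (v j))).coeff (#s + 1) = -∑ j ∈ s, v j ∧
    (X ^ 2 * ∏ j ∈ s, (X - C (v j))).coeff #s = ((∑ j ∈ s, v j) ^ 2 - ∑ j ∈ s, v j ^ 2) / 2 := by
  induction s using Finset.induction_on with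
  | empty => simp [coeff_X_pow]
  | insert a s ha ih =>
    obtain ⟨h2, h1, h0⟩ := ih
    have hdeg : (X ^ 2 * ∏ j ∈ s, (X - C (v j))).natDegree = #s + 2 := by
      rw [natDegree_mul (by simp) (prod_ne_zero_iff.2 fun j _ => X_sub_C_ne_zero _),
        natDegree_prod_of_monic _ _ fun j _ => monic_X_sub_C _]
      simp [add_comm]
    have h3 : (X ^ 2 * ∏ j ∈ s, (X - C (v j))).coeff (#s + 3) = 0 :=
      coeff_eq_zero_of_natDegree_lt (by omega)
    have hrw : X ^ 2 * ∏ j ∈ insert a s, (X - C (v j)) =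
        X * (X ^ 2 * ∏ j ∈ s, (X - C (v j))) - C (v a) * (X ^ 2 * ∏ j ∈ s, (X - C (v j))) := by
      rw [prod_insert ha]; ring
    rw [hrw, card_insert_of_notMem ha, sum_insert ha, sum_insert ha]
    refine ⟨?_, ?_, ?_⟩
    · rw [coeff_sub, coeff_C_mul, coeff_X_mul, h2, h3]; ring
    · rw [coeff_sub, coeff_C_mul, coeff_X_mul, h1, h2]; ring
    · rw [coeff_sub, coeff_C_mul, coeff_X_mul, h0, h1]; ring

/-- The polynomial form of the branching rule. -/
theorem sum_branching_weight (s : Finset ι) (v : ι → ℚ) (hv : Set.InjOn v s) :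
    ∑ i ∈ s, v i * ∏ j ∈ s.erase i, (v i - 1 - v j) / (v i - v j) =
      ∑ i ∈ s, v i - (#s : ℚ) * (#s - 1) / 2 := by
  rcases s.eq_empty_or_nonempty with rfl | hs
  · simp
  set P : ℚ[X] := ∏ j ∈ s, (X - C (v j)) with hP
  set P' : ℚ[X] := ∏ j ∈ s, (X - C (v j + 1)) with hP'
  -- The term `#s * P` cancels the coefficient of degree `#s` in `X * (P' - P)`, so `h` has degree
  -- below `#s`. It vanishes at no cost to the nodes: `P` is zero at `v i`, so `h` takes the value
  -- `v i * P'(v i)` there. The identity is then the Lagrange formula for the coefficient of degree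
  -- `#s - 1`.
  set h : ℚ[X] := X * (P' - P) + C (#s : ℚ) * P with hh
  have hX : X ^ 2 * h = X * (X ^ 2 * P' - X ^ 2 * P) + C (#s : ℚ) * (X ^ 2 * P) := by
    rw [hh]; ring
  obtain ⟨p2, p1, p0⟩ := coeff_X_sq_mul_prod s v
  obtain ⟨q2, q1, q0⟩ := coeff_X_sq_mul_prod s fun j => v j + 1
  rw [← hP] at p2 p1 p0
  rw [← hP'] at q2 q1 q0
  have hnP : P.natDegree = #s := by
    rw [hP, natDegree_prod_of_monic _ _ fun j _ => monic_X_sub_C _]; simp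
  have hnP' : P'.natDegree = #s := by
    rw [hP', natDegree_prod_of_monic _ _ fun j _ => monic_X_sub_C _]
    simp only [natDegree_X_sub_C, sum_const, smul_eq_mul, mul_one]
  have hdeg : h.degree < #s := by
    rw [degree_lt_iff_coeff_zero]
    intro m hm
    rcases hm.eq_or_lt with rfl | hm
    · have := coeff_X_pow_mul h 2 #s
      rw [← this, hX, coeff_add, coeff_C_mul, coeff_X_mul, coeff_sub, p1, p2, q1, sum_add_distrib]
      simp
    · obtain ⟨k, rfl⟩ : ∃ k, m = k + 1 := ⟨m - 1, by omega⟩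
      rw [hh, coeff_add, coeff_C_mul, coeff_X_mul, coeff_sub,
        coeff_eq_zero_of_natDegree_lt (p := P) (n := k + 1) (by omega)]
      rcases (Nat.lt_succ_iff.1 hm).eq_or_lt with rfl | hk
      · have e1 := coeff_X_pow_mul P 2 #s
        have e2 := coeff_X_pow_mul P' 2 #s
        rw [← e1, ← e2, p2, q2]; simp
      · rw [coeff_eq_zero_of_natDegree_lt (p := P) (n := k) (by omega),
          coeff_eq_zero_of_natDegree_lt (p := P') (n := k) (by omega)]
        simp
  have hco := Lagrange.coeff_eq_sum hv hdeg
  have hval : ∀ i ∈ s, h.eval (v i) / ∏ j ∈ s.erase i, (v i - v j) =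
      -(v i * ∏ j ∈ s.erase i, (v i - 1 - v j) / (v i - v j)) := by
    intro i hi
    have e1 : P.eval (v i) = 0 := by
      rw [hP, eval_prod]; exact prod_eq_zero hi (by simp)
    have e2 : P'.eval (v i) = -∏ j ∈ s.erase i, (v i - 1 - v j) := by
      rw [hP', eval_prod, ← mul_prod_erase s _ hi]
      simp only [eval_sub, eval_X, eval_C]
      rw [show v i - (v i + 1) = -1 by ring, neg_one_mul]
      congr 1
      exact prod_congr rfl fun j _ => by ring
    rw [hh, eval_add, eval_mul, eval_mul, eval_sub, eval_X, e1, e2, prod_div_distrib]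
    ring
  rw [sum_congr rfl hval, sum_neg_distrib] at hco
  have hc : h.coeff (#s - 1) = (X ^ 2 * h).coeff (#s + 1) := by
    have := coeff_X_pow_mul h 2 (#s - 1)
    rw [← this]
    congr 1
    have := card_pos.2 hs
    omega
  rw [hc, hX, coeff_add, coeff_C_mul, coeff_X_mul, coeff_sub, p0, p1, q0, sum_add_distrib] at hco
  have hsq : ∑ j ∈ s, (v j + 1) ^ 2 = ∑ j ∈ s, v j ^ 2 + 2 * ∑ j ∈ s, v j + #s := by
    simp_rw [add_sq, sum_add_distrib, mul_one, mul_sum]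
    simp
  rw [hsq] at hco
  simp only [sum_const, nsmul_eq_mul, mul_one] at hco
  linarith

end Interpolation

/-! ### Changing one entry in a product of differences. -/

/-- The product of the differences `l i - l j` over `i < j`. -/
def diffProd {N : ℕ} (l : Fin N → ℚ) : ℚ := ∏ i, ∏ j ∈ Ioi i, (l i - l j)

theorem diffProd_update {N : ℕ} (l : Fin N → ℚ) (i : Fin N) (x : ℚ) :
    diffProd (Function.update l i x) * ∏ j ∈ univ.erase i, (l i - l j) =
      diffProd l * ∏ j ∈ univ.erase i, (x - l j) := by
  -- Spread the product over the pairs `a < b`, so that the claim can be checked pair by pair. When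
  -- `b = i`, the sign changes on the two sides cancel.
  have key : ∀ y : ℚ, ∏ j ∈ univ.erase i, (y - l j) =
      ∏ a, ∏ b ∈ Ioi a, if a = i then y - l b else if b = i then y - l a else 1 := by
    intro y
    rw [← mul_prod_erase univ _ (mem_univ i)]
    have h1 : ∏ b ∈ Ioi i, (if i = i then y - l b else if b = i then y - l i else 1) =
        ∏ b ∈ Ioi i, (y - l b) := prod_congr rfl fun b _ => by simp
    have h2 : ∀ a ∈ univ.erase i,
        (∏ b ∈ Ioi a, (if a = i then y - l b else if b = i then y - l a else 1)) =
          if a < i then y - l a else 1 := by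
      intro a ha
      have hne : a ≠ i := (mem_erase.1 ha).1
      simp only [hne, if_false]
      rw [prod_ite_eq']
      simp
    rw [h1, prod_congr rfl h2, ← prod_filter]
    have h3 : (univ.erase i).filter (· < i) = Iio i := by
      ext a; simp only [mem_filter, mem_erase, mem_univ, mem_Iio]
      constructor
      · exact fun h => h.2
      · exact fun h => ⟨⟨h.ne, trivial⟩, h⟩
    have h4 : univ.erase i = Ioi i ∪ Iio i := by
      ext a; simp only [mem_erase, mem_univ, mem_union, mem_Iio, mem_Ioi, and_true]
      rw [ne_iff_lt_or_gt]
      exact or_comm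
    rw [h3, h4, prod_union]
    rw [disjoint_left]
    intro a ha hb
    exact absurd (mem_Ioi.1 ha) (not_lt.2 (mem_Iio.1 hb).le)
  rw [key, key]
  unfold diffProd
  rw [← prod_mul_distrib, ← prod_mul_distrib]
  refine prod_congr rfl fun a _ => ?_
  rw [← prod_mul_distrib, ← prod_mul_distrib]
  refine prod_congr rfl fun b hb => ?_
  have hab : a < b := mem_Ioi.1 hb
  by_cases ha : a = i
  · subst ha
    simp only [Function.update_self, Function.update_of_ne hab.ne', if_true]
    ring
  · by_cases hbi : b = i
    · subst hbi
      simp only [Function.update_self, Function.update_of_ne ha, ha, if_true, if_false]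
      ring
    · simp [ha, hbi, Function.update_of_ne]

/-! ### Young diagrams through their row lengths, and adding one cell. -/

theorem rowLen_eq_of_mem_iff {μ : YoungDiagram} {k r : ℕ} (h : ∀ j, (k, j) ∈ μ ↔ j < r) :
    μ.rowLen k = r :=
  eq_of_forall_lt_iff fun j => by rw [← YoungDiagram.mem_iff_lt_rowLen, h]

theorem ext_rowLen {μ ν : YoungDiagram} (h : ∀ k, μ.rowLen k = ν.rowLen k) : μ = ν := by
  apply YoungDiagram.ext
  ext ⟨i, j⟩
  rw [YoungDiagram.mem_cells, YoungDiagram.mem_cells, YoungDiagram.mem_iff_lt_rowLen,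
    YoungDiagram.mem_iff_lt_rowLen, h]

theorem exists_rowLen_eq (r : ℕ → ℕ) (hr : Antitone r) (N : ℕ) (hN : r N = 0) :
    ∃ μ : YoungDiagram, ∀ k, μ.rowLen k = r k := by
  refine ⟨⟨(range N ×ˢ range (r 0)).filter fun c => c.2 < r c.1, ?_⟩, ?_⟩
  · rintro ⟨a, b⟩ ⟨c, d⟩ ⟨h1, h2⟩ h
    simp only [coe_filter, mem_product, mem_range, Set.mem_ofPred_eq] at h ⊢
    simp only at h1 h2
    have := hr h1
    omega
  · intro k
    refine rowLen_eq_of_mem_iff fun j => ?_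
    rw [← YoungDiagram.mem_cells]
    simp only [mem_filter, mem_product, mem_range]
    refine ⟨fun h => h.2, fun h => ⟨⟨?_, ?_⟩, h⟩⟩
    · by_contra hk
      have := hr (not_lt.1 hk)
      omega
    · exact h.trans_le (hr (Nat.zero_le k))

theorem card_eq_sum_rowLen {μ : YoungDiagram} {N : ℕ} (h : μ.rowLen N = 0) :
    μ.card = ∑ i : Fin N, μ.rowLen i := by
  rw [Fin.sum_univ_eq_sum_range (fun i => μ.rowLen i) N]
  have hmaps : ∀ c ∈ μ.cells, c.1 ∈ range N := by
    rintro ⟨i, j⟩ hc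
    rw [mem_range]
    by_contra hi
    have h1 := YoungDiagram.mem_iff_lt_rowLen.1 ((YoungDiagram.mem_cells _).1 hc)
    have h2 := μ.rowLen_anti N i (not_lt.1 hi)
    omega
  rw [YoungDiagram.card, card_eq_sum_card_fiberwise hmaps]
  exact sum_congr rfl fun i _ => (YoungDiagram.rowLen_eq_card μ).symm

theorem mem_partitionsOf {n : ℕ} {μ : YoungDiagram} : μ ∈ partitionsOf n ↔ μ.card = n := by
  simp [partitionsOf]

theorem rowLen_card (μ : YoungDiagram) : μ.rowLen μ.card = 0 := by
  by_contra h
  have h1 := YoungDiagram.mem_iff_lt_rowLen.2 (Nat.pos_of_ne_zero h)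
  have h2 := YoungDiagram.mem_iff_lt_colLen.1 h1
  have h3 : μ.colLen 0 ≤ μ.card := by
    rw [YoungDiagram.colLen_eq_card]
    exact card_le_card (filter_subset _ _)
  omega

theorem rowLen_eq_zero_of_le {μ : YoungDiagram} {n : ℕ} (h : μ.card ≤ n) : μ.rowLen n = 0 :=
  Nat.le_zero.1 ((μ.rowLen_anti _ _ h).trans (rowLen_card μ).le)

/-- The diagram `μ` is obtained from `ν` by adding one cell at the end of row `i`. -/
def AddsCell (ν μ : YoungDiagram) (i : ℕ) : Prop :=
  ∀ k, μ.rowLen k = ν.rowLen k + if k = i then 1 else 0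

namespace AddsCell

variable {ν μ : YoungDiagram} {i : ℕ}

theorem le (h : AddsCell ν μ i) : ν ≤ μ := by
  rintro ⟨a, b⟩ hab
  have hab' : (a, b) ∈ ν := hab
  rw [YoungDiagram.mem_iff_lt_rowLen] at hab' ⊢
  rw [h a]
  omega

theorem card_eq (h : AddsCell ν μ i) : μ.card = ν.card + 1 := by
  obtain ⟨M, h1, h2, h3⟩ : ∃ M, μ.card ≤ M ∧ ν.card ≤ M ∧ i < M :=
    ⟨μ.card + ν.card + i + 1, by omega, by omega, by omega⟩
  have hμ := rowLen_eq_zero_of_le h1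
  have hν := rowLen_eq_zero_of_le h2
  rw [card_eq_sum_rowLen hμ, card_eq_sum_rowLen hν, Fin.sum_univ_eq_sum_range (fun i => μ.rowLen i),
    Fin.sum_univ_eq_sum_range (fun i => ν.rowLen i), sum_congr rfl fun k _ => h k, sum_add_distrib,
    sum_ite_eq', if_pos (mem_range.2 h3)]

theorem eq_left {ν' : YoungDiagram} (h : AddsCell ν μ i) (h' : AddsCell ν' μ i) : ν = ν' :=
  ext_rowLen fun k => by have := h k; have := h' k; omega

theorem eq_right {μ' : YoungDiagram} (h : AddsCell ν μ i) (h' : AddsCell ν μ' i) : μ = μ' :=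
  ext_rowLen fun k => by have := h k; have := h' k; omega

end AddsCell

theorem exists_addsCell {ν μ : YoungDiagram} (hle : ν ≤ μ) (hc : μ.card = ν.card + 1) :
    ∃ i, AddsCell ν μ i := by
  obtain ⟨c, hcν, hins⟩ : ∃ c ∉ ν.cells, insert c ν.cells = μ.cells :=
    exists_eq_insert_iff.2 ⟨YoungDiagram.cells_subset_iff.2 hle, hc.symm⟩
  refine ⟨c.1, fun k => ?_⟩
  rw [YoungDiagram.rowLen_eq_card, YoungDiagram.rowLen_eq_card, YoungDiagram.row,
    YoungDiagram.row, ← hins, filter_insert]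
  split_ifs with h1 h2 h2
  · rw [card_insert_of_notMem fun h => hcν (mem_filter.1 h).1]
  · exact absurd h1.symm h2
  · exact absurd h2.symm h1
  · rfl

theorem exists_addsCell_left {μ : YoungDiagram} {i : ℕ} (h : μ.rowLen (i + 1) < μ.rowLen i) :
    ∃ ν, AddsCell ν μ i := by
  obtain ⟨ν, hν⟩ := exists_rowLen_eq (fun k => μ.rowLen k - if k = i then 1 else 0)
    (antitone_nat_of_succ_le fun k => by
      have := μ.rowLen_anti k (k + 1) (Nat.le_succ k)
      by_cases hk : k = i
      · subst hk; simp; omega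
      · simp only [hk, if_false]; omega) μ.card (by simp [rowLen_card])
  refine ⟨ν, fun k => ?_⟩
  rw [hν]
  split_ifs with hk
  · subst hk; omega
  · rfl

theorem exists_addsCell_right {ν : YoungDiagram} {i : ℕ}
    (h : ∀ k, k + 1 = i → ν.rowLen i < ν.rowLen k) : ∃ μ, AddsCell ν μ i := by
  obtain ⟨μ, hμ⟩ := exists_rowLen_eq (fun k => ν.rowLen k + if k = i then 1 else 0)
    (antitone_nat_of_succ_le fun k => by
      have := ν.rowLen_anti k (k + 1) (Nat.le_succ k)
      by_cases hk : k + 1 = i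
      · have := h k hk
        subst hk; simp; omega
      · simp only [hk, if_false]; omega) (ν.card + i + 1) (by
        rw [rowLen_eq_zero_of_le (by omega), if_neg (by omega)])
  exact ⟨μ, hμ⟩

/-! ### Standard tableaux and the branching rule. -/

/-- Standard Young tableaux of shape `μ`, as functions on all pairs that vanish outside `μ` and
take the values `0, …, μ.card - 1` on `μ`. -/
def sytSet (μ : YoungDiagram) : Set (ℕ × ℕ → ℕ) :=
  {T | (∀ c, c ∉ μ → T c = 0) ∧ (∀ c ∈ μ, T c < μ.card) ∧
    (∀ c ∈ μ, ∀ d ∈ μ, T c = T d → c = d) ∧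
    (∀ c ∈ μ, ∀ d ∈ μ, c.1 = d.1 → c.2 < d.2 → T c < T d) ∧
    (∀ c ∈ μ, ∀ d ∈ μ, c.2 = d.2 → c.1 < d.1 → T c < T d)}

open Classical in
theorem numSYT_eq_card_sytSet (μ : YoungDiagram) : numSYT μ = Nat.card (sytSet μ) := by
  unfold numSYT
  let F : (μ.cells ≃ Fin μ.card) → ℕ × ℕ → ℕ :=
    fun T c => if h : c ∈ μ.cells then (T ⟨c, h⟩ : ℕ) else 0
  have hF : ∀ (T) (c : ℕ × ℕ) (h : c ∈ μ), F T c = T ⟨c, h⟩ := fun T c h => dif_pos h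
  refine Nat.card_eq_of_bijective (fun T => ⟨F T.1, ?_⟩) ⟨?_, ?_⟩
  · obtain ⟨T, h1, h2⟩ := T
    refine ⟨fun c hc => dif_neg hc, fun c hc => ?_, fun c hc d hd h => ?_,
      fun c hc d hd e h => ?_, fun c hc d hd e h => ?_⟩
    · rw [hF _ _ hc]; exact Fin.is_lt _
    · rw [hF _ _ hc, hF _ _ hd] at h
      exact congrArg Subtype.val (T.injective (Fin.ext h))
    · rw [hF _ _ hc, hF _ _ hd]; exact h1 ⟨c, hc⟩ ⟨d, hd⟩ e h
    · rw [hF _ _ hc, hF _ _ hd]; exact h2 ⟨c, hc⟩ ⟨d, hd⟩ e h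
  · rintro ⟨T, hT⟩ ⟨T', hT'⟩ h
    refine Subtype.ext (Equiv.ext fun c => Fin.ext ?_)
    have h' := congrFun (congrArg Subtype.val h) c.1
    simp only at h'
    rwa [hF _ _ c.2, hF _ _ c.2] at h'
  · rintro ⟨T, h0, h1, h2, h3, h4⟩
    let f : μ.cells → Fin μ.card := fun c => ⟨T c.1, h1 c.1 c.2⟩
    have hf : Function.Injective f := fun c d h =>
      Subtype.ext (h2 c.1 c.2 d.1 d.2 (congrArg Fin.val h))
    have hb : Function.Bijective f :=
      (Fintype.bijective_iff_injective_and_card f).2 ⟨hf, by simp [YoungDiagram.card]⟩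
    refine ⟨⟨Equiv.ofBijective f hb, fun c d e h => h3 c.1 c.2 d.1 d.2 e h,
      fun c d e h => h4 c.1 c.2 d.1 d.2 e h⟩, Subtype.ext (funext fun c => ?_)⟩
    by_cases hc : c ∈ μ
    · exact hF _ _ hc
    · exact (dif_neg hc).trans (h0 c hc).symm

theorem sytSet_finite (μ : YoungDiagram) : Finite (sytSet μ) := by
  let f : sytSet μ → μ.cells → Fin μ.card := fun T c => ⟨T.1 c.1, T.2.2.1 c.1 c.2⟩
  refine Finite.of_injective f fun T T' h => Subtype.ext (funext fun c => ?_)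
  by_cases hc : c ∈ μ
  · exact congrArg Fin.val (congrFun h ⟨c, hc⟩)
  · rw [T.2.1 c hc, T'.2.1 c hc]

theorem sytSet_mono {μ : YoungDiagram} {T : ℕ × ℕ → ℕ} (hT : T ∈ sytSet μ) {c d : ℕ × ℕ}
    (hcd : c ≤ d) (hd : d ∈ μ) : T c ≤ T d := by
  obtain ⟨-, -, -, h3, h4⟩ := hT
  obtain ⟨a, b⟩ := c
  obtain ⟨a', b'⟩ := d
  obtain ⟨ha, hb⟩ := hcd
  simp only at ha hb
  have hm : (a, b') ∈ μ := μ.up_left_mem ha le_rfl hd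
  have hc : (a, b) ∈ μ := μ.up_left_mem ha hb hd
  have e1 : T (a, b) ≤ T (a, b') := by
    rcases hb.eq_or_lt with rfl | hb
    · exact le_rfl
    · exact (h3 _ hc _ hm rfl hb).le
  have e2 : T (a, b') ≤ T (a', b') := by
    rcases ha.eq_or_lt with rfl | ha
    · exact le_rfl
    · exact (h4 _ hm _ hd rfl ha).le
  exact e1.trans e2

open Classical in
/-- Removing the cell with the largest entry from a standard Young tableau. -/
theorem numSYT_eq_sum {n : ℕ} {μ : YoungDiagram} (hμ : μ.card = n + 1) :
    numSYT μ = ∑ ν ∈ partitionsOf n with ν ≤ μ, numSYT ν := by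
  simp_rw [numSYT_eq_card_sytSet]
  rw [← sum_coe_sort]
  have := sytSet_finite
  rw [← Nat.card_sigma]
  symm
  -- The inverse of the removal: the one cell of `μ` outside `ν` receives the largest entry, which
  -- is `n` because entries start at 0.
  let G : YoungDiagram → (ℕ × ℕ → ℕ) → ℕ × ℕ → ℕ :=
    fun ν T c => if c ∈ ν then T c else if c ∈ μ then n else 0
  refine Nat.card_eq_of_bijective
    (fun p : Σ ν : {ν // ν ∈ (partitionsOf n).filter (· ≤ μ)}, sytSet ν.1 =>
      (⟨G p.1.1 p.2.1, ?_⟩ : sytSet μ)) ⟨?_, ?_⟩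
  · obtain ⟨⟨ν, hν⟩, T, h0, h1, h2, h3, h4⟩ := p
    obtain ⟨hνn, hle⟩ := mem_filter.1 hν
    rw [mem_partitionsOf] at hνn
    change ∀ c ∈ ν, T c < ν.card at h1
    obtain ⟨x, hxν, hins⟩ : ∃ c ∉ ν.cells, insert c ν.cells = μ.cells :=
      exists_eq_insert_iff.2 ⟨YoungDiagram.cells_subset_iff.2 hle, by
        change ν.card + 1 = μ.card; omega⟩
    have hmem : ∀ c, c ∈ μ ↔ c = x ∨ c ∈ ν := fun c => by
      rw [← YoungDiagram.mem_cells, ← hins, mem_insert, YoungDiagram.mem_cells]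
    have hG1 : ∀ c ∈ ν, G ν T c = T c := fun c hc => if_pos hc
    have hG2 : G ν T x = n := (if_neg hxν).trans (if_pos ((hmem x).2 (Or.inl rfl)))
    have hinc : ∀ c ∈ μ, ∀ d ∈ μ, c ≤ d → c ≠ d → (c ∈ ν → d ∈ ν → T c < T d) →
        G ν T c < G ν T d := by
      intro c hc d hd hcd hne hT
      rcases (hmem d).1 hd with rfl | hd
      · rcases (hmem c).1 hc with rfl | hc
        · exact absurd rfl hne
        · rw [hG1 c hc, hG2, ← hνn]; exact h1 c hc
      · have hc' : c ∈ ν := ν.up_left_mem hcd.1 hcd.2 hd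
        rw [hG1 c hc', hG1 d hd]; exact hT hc' hd
    refine ⟨fun c hc => ?_, fun c hc => ?_, fun c hc d hd h => ?_,
      fun c hc d hd e h => ?_, fun c hc d hd e h => ?_⟩
    · exact (if_neg fun h => hc (hle h)).trans (if_neg hc)
    · rw [hμ]
      rcases (hmem c).1 hc with rfl | hc
      · simp only [hG2]; omega
      · have := h1 c hc
        simp only [hG1 c hc]; omega
    · simp only at h
      rcases (hmem c).1 hc with rfl | hc <;> rcases (hmem d).1 hd with rfl | hd
      · rfl
      · rw [hG2, hG1 d hd] at h
        have := h1 d hd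
        omega
      · rw [hG2, hG1 c hc] at h
        have := h1 c hc
        omega
      · rw [hG1 c hc, hG1 d hd] at h
        exact h2 c hc d hd h
    · exact hinc c hc d hd ⟨e.le, h.le⟩ (fun he => by simp [he] at h)
        fun hc hd => h3 c hc d hd e h
    · exact hinc c hc d hd ⟨h.le, e.le⟩ (fun he => by simp [he] at h)
        fun hc hd => h4 c hc d hd e h
  · rintro ⟨⟨ν, hν⟩, T, hT⟩ ⟨⟨ν', hν'⟩, T', hT'⟩ h
    have hG : ∀ c, G ν T c = G ν' T' c := fun c => congrFun (congrArg Subtype.val h) c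
    -- The smaller shape can be read off from the extended tableau as the cells with entry below
    -- `n`, which gives injectivity.
    have key : ∀ (ν) (hν : ν ∈ (partitionsOf n).filter (· ≤ μ)) (T) (hT : T ∈ sytSet ν) (c),
        c ∈ ν ↔ c ∈ μ ∧ G ν T c < n := by
      intro ν hν T hT c
      obtain ⟨hνn, hle⟩ := mem_filter.1 hν
      rw [mem_partitionsOf] at hνn
      constructor
      · intro hc
        refine ⟨hle hc, ?_⟩
        have : G ν T c = T c := if_pos hc
        rw [this, ← hνn]
        exact hT.2.1 c hc
      · rintro ⟨hc, hlt⟩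
        by_contra hcν
        have : G ν T c = n := (if_neg hcν).trans (if_pos hc)
        omega
    have hνν : ν = ν' := by
      apply YoungDiagram.ext
      ext c
      rw [YoungDiagram.mem_cells, YoungDiagram.mem_cells, key ν hν T hT, key ν' hν' T' hT', hG]
    subst hνν
    have hTT : T = T' := by
      funext c
      by_cases hc : c ∈ ν
      · have := hG c
        simpa only [G, if_pos hc] using this
      · rw [hT.1 c hc, hT'.1 c hc]
    subst hTT
    rfl
  · rintro ⟨T, hT⟩
    have hT' := hT
    obtain ⟨h0, h1, h2, h3, h4⟩ := hT'
    let ν : YoungDiagram := ⟨μ.cells.filter fun c => T c < n, by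
      rintro d c hcd hd
      simp only [coe_filter, Set.mem_ofPred_eq] at hd ⊢
      exact ⟨μ.up_left_mem hcd.1 hcd.2 hd.1, (sytSet_mono hT hcd hd.1).trans_lt hd.2⟩⟩
    have hmem : ∀ c, c ∈ ν ↔ c ∈ μ ∧ T c < n := fun c => mem_filter
    -- By counting, every value `0, …, n` occurs, so exactly `n` cells have an entry below `n`.
    have himg : μ.cells.image T = range (n + 1) := by
      apply eq_of_subset_of_card_le
      · intro x hx
        obtain ⟨c, hc, rfl⟩ := mem_image.1 hx
        rw [mem_range, ← hμ]
        exact h1 c hc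
      · rw [card_range, card_image_of_injOn fun c hc d hd h => h2 c hc d hd h, ← hμ]
    have hcard : ν.card = n := by
      have hi : ν.cells.image T = range n := by
        ext x
        simp only [mem_image, mem_range, YoungDiagram.mem_cells, hmem]
        constructor
        · rintro ⟨c, hc, rfl⟩; exact hc.2
        · intro hx
          have : x ∈ μ.cells.image T := by rw [himg, mem_range]; omega
          obtain ⟨c, hc, rfl⟩ := mem_image.1 this
          exact ⟨c, ⟨hc, hx⟩, rfl⟩
      rw [YoungDiagram.card, ← card_image_of_injOn (f := T) (s := ν.cells), hi, card_range]
      intro c hc d hd h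
      exact h2 c ((hmem c).1 hc).1 d ((hmem d).1 hd).1 h
    have hle : ν ≤ μ := fun c hc => ((hmem c).1 hc).1
    refine ⟨⟨⟨ν, mem_filter.2 ⟨mem_partitionsOf.2 hcard, hle⟩⟩,
      fun c => if c ∈ ν then T c else 0, ?_, ?_, ?_, ?_, ?_⟩, ?_⟩
    · exact fun c hc => if_neg hc
    · intro c hc
      simp only at hc ⊢
      rw [if_pos hc, hcard]; exact ((hmem c).1 hc).2
    · intro c hc d hd h
      simp only at hc hd h
      rw [if_pos hc, if_pos hd] at h
      exact h2 c (hle hc) d (hle hd) h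
    · intro c hc d hd e h
      simp only at hc hd ⊢
      rw [if_pos hc, if_pos hd]
      exact h3 c (hle hc) d (hle hd) e h
    · intro c hc d hd e h
      simp only at hc hd ⊢
      rw [if_pos hc, if_pos hd]
      exact h4 c (hle hc) d (hle hd) e h
    · refine Subtype.ext (funext fun c => ?_)
      change (if c ∈ ν then (if c ∈ ν then T c else 0) else if c ∈ μ then n else 0) = T c
      by_cases hc : c ∈ ν
      · rw [if_pos hc, if_pos hc]
      · rw [if_neg hc]
        by_cases hcμ : c ∈ μ
        · rw [if_pos hcμ]
          have e1 := h1 c hcμ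
          have e2 : ¬ T c < n := fun h => hc ((hmem c).2 ⟨hcμ, h⟩)
          omega
        · rw [if_neg hcμ, h0 c hcμ]

theorem eq_bot_of_card_eq_zero {μ : YoungDiagram} (h : μ.card = 0) : μ = ⊥ :=
  YoungDiagram.ext (by rw [card_eq_zero.1 h, YoungDiagram.cells_bot])

theorem numSYT_of_card_eq_zero {μ : YoungDiagram} (h : μ.card = 0) : numSYT μ = 1 := by
  rw [numSYT_eq_card_sytSet]
  have hc : ∀ c, c ∉ μ := fun c hc => by
    have : c ∈ μ.cells := hc
    rw [card_eq_zero.1 h] at this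
    simp at this
  rw [Nat.card_eq_one_iff_exists]
  refine ⟨⟨fun _ => 0, fun _ _ => rfl, fun c hc' => absurd hc' (hc c),
    fun c hc' => absurd hc' (hc c), fun c hc' => absurd hc' (hc c),
    fun c hc' => absurd hc' (hc c)⟩, ?_⟩
  rintro ⟨T, hT⟩
  exact Subtype.ext (funext fun c => hT.1 c (hc c))

/-! ### Sums over neighbouring diagrams as sums over rows. -/

-- A neighbour is determined by the row of its extra cell. The explicit weights `g` vanish at rows
-- that give no diagram, so the sum may run over all rows, as the interpolation identities require.
open Classical in
theorem sum_below_eq_sum_rows {M : Type*} [AddCommMonoid M] {n N : ℕ} {μ : YoungDiagram}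
    (hμ : μ.card = n + 1) (hN : μ.rowLen N = 0) (F : YoungDiagram → M) (g : Fin N → M)
    (hF : ∀ ν (i : Fin N), AddsCell ν μ i → F ν = g i)
    (hg : ∀ i : Fin N, (¬ ∃ ν, AddsCell ν μ i) → g i = 0) :
    ∑ ν ∈ partitionsOf n with ν ≤ μ, F ν = ∑ i, g i := by
  rw [← sum_filter_of_ne (s := univ) (p := fun i : Fin N => ∃ ν, AddsCell ν μ i)
    fun i _ hi => by_contra fun h => hi (hg i h)]
  have hex : ∀ ν ∈ (partitionsOf n).filter (· ≤ μ), ∃ i : Fin N, AddsCell ν μ i := by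
    intro ν hν
    rw [mem_filter, mem_partitionsOf] at hν
    obtain ⟨i, hi⟩ := exists_addsCell hν.2 (by omega)
    refine ⟨⟨i, ?_⟩, hi⟩
    by_contra h
    have h1 := μ.rowLen_anti N i (not_lt.1 h)
    have h2 := hi i
    simp at h2
    omega
  refine sum_bij (fun ν hν => (hex ν hν).choose) (fun ν hν => ?_) (fun ν hν ν' hν' h => ?_)
    (fun i hi => ?_) fun ν hν => hF _ _ (hex ν hν).choose_spec
  · exact mem_filter.2 ⟨mem_univ _, ν, (hex ν hν).choose_spec⟩
  · have h1 := (hex ν hν).choose_spec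
    rw [h] at h1
    exact h1.eq_left (hex ν' hν').choose_spec
  · obtain ⟨ν, hν⟩ := (mem_filter.1 hi).2
    have hm : ν ∈ (partitionsOf n).filter (· ≤ μ) := by
      rw [mem_filter, mem_partitionsOf]
      exact ⟨by have := hν.card_eq; omega, hν.le⟩
    refine ⟨ν, hm, ?_⟩
    have h1 := (hex ν hm).choose_spec
    have h2 := h1 i
    have h3 := hν i
    by_contra hne
    rw [if_pos rfl] at h3
    rw [if_neg fun h => hne (Fin.ext h.symm)] at h2
    omega

open Classical in
theorem sum_above_eq_sum_rows {M : Type*} [AddCommMonoid M] {n : ℕ} {ν : YoungDiagram}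
    (hν : ν.card = n) (F : YoungDiagram → M) (g : Fin (n + 1) → M)
    (hF : ∀ μ (i : Fin (n + 1)), AddsCell ν μ i → F μ = g i)
    (hg : ∀ i : Fin (n + 1), (¬ ∃ μ, AddsCell ν μ i) → g i = 0) :
    ∑ μ ∈ partitionsOf (n + 1) with ν ≤ μ, F μ = ∑ i, g i := by
  rw [← sum_filter_of_ne (s := univ) (p := fun i : Fin (n + 1) => ∃ μ, AddsCell ν μ i)
    fun i _ hi => by_contra fun h => hi (hg i h)]
  have hex : ∀ μ ∈ (partitionsOf (n + 1)).filter (ν ≤ ·), ∃ i : Fin (n + 1), AddsCell ν μ i := by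
    intro μ hμ
    rw [mem_filter, mem_partitionsOf] at hμ
    obtain ⟨i, hi⟩ := exists_addsCell hμ.2 (by omega)
    refine ⟨⟨i, ?_⟩, hi⟩
    by_contra h
    have h1 := μ.rowLen_anti (n + 1) i (not_lt.1 h)
    have h2 := hi i
    have h3 := rowLen_eq_zero_of_le hμ.1.le
    simp at h2
    omega
  refine sum_bij (fun μ hμ => (hex μ hμ).choose) (fun μ hμ => ?_) (fun μ hμ μ' hμ' h => ?_)
    (fun i hi => ?_) fun μ hμ => hF _ _ (hex μ hμ).choose_spec
  · exact mem_filter.2 ⟨mem_univ _, μ, (hex μ hμ).choose_spec⟩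
  · have h1 := (hex μ hμ).choose_spec
    rw [h] at h1
    exact h1.eq_right (hex μ' hμ').choose_spec
  · obtain ⟨μ, hμ⟩ := (mem_filter.1 hi).2
    have hm : μ ∈ (partitionsOf (n + 1)).filter (ν ≤ ·) := by
      rw [mem_filter, mem_partitionsOf]
      exact ⟨by have := hμ.card_eq; omega, hμ.le⟩
    refine ⟨μ, hm, ?_⟩
    have h1 := (hex μ hm).choose_spec
    have h2 := h1 i
    have h3 := hμ i
    by_contra hne
    rw [if_pos rfl] at h3
    rw [if_neg fun h => hne (Fin.ext h.symm)] at h2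
    omega

/-! ### The formula of Frobenius. -/

/-- The shifted parts of `μ`, with respect to `N` rows. -/
def shiftedPart (N : ℕ) (μ : YoungDiagram) (i : Fin N) : ℕ := μ.rowLen i + (N - 1 - i)

theorem shiftedPart_lt {N : ℕ} {μ : YoungDiagram} {i j : Fin N} (h : i < j) :
    shiftedPart N μ j < shiftedPart N μ i := by
  have h1 := μ.rowLen_anti i j h.le
  have h2 : (i : ℕ) < j := h
  have h3 := j.2
  unfold shiftedPart
  omega

theorem shiftedPart_injective (N : ℕ) (μ : YoungDiagram) : Function.Injective (shiftedPart N μ) :=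
  StrictAnti.injective fun _ _ h => shiftedPart_lt h

theorem cast_shiftedPart_injective (N : ℕ) (μ : YoungDiagram) :
    Function.Injective fun i => (shiftedPart N μ i : ℚ) :=
  Nat.cast_injective.comp (shiftedPart_injective N μ)

theorem prod_sub_shiftedPart_ne_zero (N : ℕ) (μ : YoungDiagram) (i : Fin N) :
    ∏ j ∈ univ.erase i, ((shiftedPart N μ i : ℚ) - shiftedPart N μ j) ≠ 0 :=
  prod_ne_zero_iff.2 fun _ hj => sub_ne_zero.2 fun h =>
    (mem_erase.1 hj).1 (cast_shiftedPart_injective N μ h.symm)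

theorem AddsCell.shiftedPart_eq {ν μ : YoungDiagram} {N : ℕ} {i : Fin N} (h : AddsCell ν μ i)
    (k : Fin N) : shiftedPart N μ k = shiftedPart N ν k + if k = i then 1 else 0 := by
  unfold shiftedPart
  rw [h k, add_right_comm]
  simp only [Fin.ext_iff]

/-- The determinantal expression for `f_μ / μ.card!`. -/
noncomputable def frobenius (N : ℕ) (μ : YoungDiagram) : ℚ :=
  diffProd (fun i => (shiftedPart N μ i : ℚ)) / ∏ i, ((shiftedPart N μ i).factorial : ℚ)

theorem AddsCell.diffProd_left {ν μ : YoungDiagram} {N : ℕ} {i : Fin N} (h : AddsCell ν μ i) :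
    diffProd (fun k => (shiftedPart N ν k : ℚ)) = diffProd (fun k => (shiftedPart N μ k : ℚ)) *
      ∏ j ∈ univ.erase i, ((shiftedPart N μ i : ℚ) - 1 - shiftedPart N μ j) /
        ((shiftedPart N μ i : ℚ) - shiftedPart N μ j) := by
  have hu : (fun k => (shiftedPart N ν k : ℚ)) =
      Function.update (fun k => (shiftedPart N μ k : ℚ)) i (shiftedPart N μ i - 1) := by
    funext k
    rw [Function.update_apply]
    have hk := h.shiftedPart_eq k
    split_ifs with hki
    · subst hki
      rw [hk]; simp
    · rw [hk]; simp [hki]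
  rw [prod_div_distrib, mul_div_assoc', eq_div_iff (prod_sub_shiftedPart_ne_zero N μ i), hu]
  exact diffProd_update (fun k => (shiftedPart N μ k : ℚ)) i _

theorem AddsCell.diffProd_right {ν μ : YoungDiagram} {N : ℕ} {i : Fin N} (h : AddsCell ν μ i) :
    diffProd (fun k => (shiftedPart N μ k : ℚ)) = diffProd (fun k => (shiftedPart N ν k : ℚ)) *
      ∏ j ∈ univ.erase i, ((shiftedPart N ν i : ℚ) + 1 - shiftedPart N ν j) /
        ((shiftedPart N ν i : ℚ) - shiftedPart N ν j) := by
  have hu : (fun k => (shiftedPart N μ k : ℚ)) =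
      Function.update (fun k => (shiftedPart N ν k : ℚ)) i (shiftedPart N ν i + 1) := by
    funext k
    rw [Function.update_apply]
    have hk := h.shiftedPart_eq k
    split_ifs with hki
    · subst hki
      rw [hk]; simp
    · rw [hk]; simp [hki]
  rw [prod_div_distrib, mul_div_assoc', eq_div_iff (prod_sub_shiftedPart_ne_zero N ν i), hu]
  exact diffProd_update (fun k => (shiftedPart N ν k : ℚ)) i _

theorem AddsCell.prod_factorial {ν μ : YoungDiagram} {N : ℕ} {i : Fin N} (h : AddsCell ν μ i) :
    ∏ k, ((shiftedPart N μ k).factorial : ℚ) =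
      (shiftedPart N ν i + 1) * ∏ k, ((shiftedPart N ν k).factorial : ℚ) := by
  rw [← mul_prod_erase univ _ (mem_univ i),
    ← mul_prod_erase univ (fun k => ((shiftedPart N ν k).factorial : ℚ)) (mem_univ i), ← mul_assoc]
  congr 1
  · rw [h.shiftedPart_eq i, if_pos rfl, Nat.factorial_succ]
    push_cast
    rfl
  · refine prod_congr rfl fun k hk => ?_
    rw [h.shiftedPart_eq k, if_neg (mem_erase.1 hk).1, add_zero]

theorem prod_factorial_shiftedPart_ne_zero (N : ℕ) (μ : YoungDiagram) :
    ∏ k, ((shiftedPart N μ k).factorial : ℚ) ≠ 0 :=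
  prod_ne_zero_iff.2 fun _ _ => Nat.cast_ne_zero.2 (Nat.factorial_ne_zero _)

/-- The ratio is put in the shape of the summand of `sum_branching_weight`;
`AddsCell.frobenius_right` does the same for `sum_growth_weight`. -/
theorem AddsCell.frobenius_left {ν μ : YoungDiagram} {N : ℕ} {i : Fin N} (h : AddsCell ν μ i) :
    frobenius N ν = frobenius N μ * (shiftedPart N μ i *
      ∏ j ∈ univ.erase i, ((shiftedPart N μ i : ℚ) - 1 - shiftedPart N μ j) /
        ((shiftedPart N μ i : ℚ) - shiftedPart N μ j)) := by
  have h1 : (shiftedPart N μ i : ℚ) = shiftedPart N ν i + 1 := by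
    rw [h.shiftedPart_eq i, if_pos rfl]; push_cast; rfl
  have h2 := prod_factorial_shiftedPart_ne_zero N ν
  have h3 : (shiftedPart N ν i : ℚ) + 1 ≠ 0 := by positivity
  unfold frobenius
  rw [h.diffProd_left, h.prod_factorial, ← h1]
  rw [← h1] at h3
  field_simp

theorem AddsCell.frobenius_right {ν μ : YoungDiagram} {N : ℕ} {i : Fin N} (h : AddsCell ν μ i) :
    frobenius N μ = frobenius N ν *
      ((∏ j ∈ univ.erase i, ((shiftedPart N ν i : ℚ) + 1 - shiftedPart N ν j) /
        ((shiftedPart N ν i : ℚ) - shiftedPart N ν j)) / (shiftedPart N ν i + 1)) := by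
  have h2 := prod_factorial_shiftedPart_ne_zero N ν
  have h3 : (shiftedPart N ν i : ℚ) + 1 ≠ 0 := by positivity
  unfold frobenius
  rw [h.diffProd_right, h.prod_factorial]
  field_simp

theorem prod_Ioi_sub_eq_factorial {N : ℕ} (i : Fin N) :
    ∏ j ∈ Ioi i, ((j : ℕ) - (i : ℕ)) = (N - 1 - i).factorial := by
  rw [← prod_range_add_one_eq_factorial]
  refine prod_bij (fun j _ => (j : ℕ) - i - 1) (fun j hj => ?_) (fun j hj k hk h => ?_)
    (fun k hk => ?_) (fun j hj => ?_)
  · have : (i : ℕ) < j := Fin.lt_def.1 (mem_Ioi.1 hj)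
    have := j.2
    rw [mem_range]; omega
  · have : (i : ℕ) < j := Fin.lt_def.1 (mem_Ioi.1 hj)
    have : (i : ℕ) < k := Fin.lt_def.1 (mem_Ioi.1 hk)
    exact Fin.ext (by omega)
  · rw [mem_range] at hk
    exact ⟨⟨i + k + 1, by omega⟩, mem_Ioi.2 (Fin.lt_def.2 (by simp only; omega)),
      by simp only; omega⟩
  · have : (i : ℕ) < j := Fin.lt_def.1 (mem_Ioi.1 hj)
    omega

theorem frobenius_of_rowLen_eq_zero {N : ℕ} {μ : YoungDiagram} (h : ∀ k, μ.rowLen k = 0) :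
    frobenius N μ = 1 := by
  unfold frobenius
  rw [div_eq_one_iff_eq (prod_factorial_shiftedPart_ne_zero N μ)]
  refine prod_congr rfl fun i _ => ?_
  rw [shiftedPart, h, zero_add, ← prod_Ioi_sub_eq_factorial, Nat.cast_prod]
  refine prod_congr rfl fun j hj => ?_
  have h1 : (i : ℕ) < j := Fin.lt_def.1 (mem_Ioi.1 hj)
  have h2 := j.2
  simp only [shiftedPart, h, zero_add]
  rw [← Nat.cast_sub (by omega)]
  congr 1
  omega

theorem sum_shiftedPart {N : ℕ} {μ : YoungDiagram} (hN : μ.rowLen N = 0) :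
    ∑ i, (shiftedPart N μ i : ℚ) = μ.card + (N : ℚ) * (N - 1) / 2 := by
  have h1 : ∑ i : Fin N, (N - 1 - (i : ℕ)) = ∑ i ∈ range N, i := by
    rw [Fin.sum_univ_eq_sum_range (fun i => N - 1 - i) N]
    exact sum_range_reflect (fun i => i) N
  have h2 := Finset.sum_range_id_mul_two N
  rw [← h1] at h2
  have h3 : ((∑ i : Fin N, (N - 1 - (i : ℕ)) : ℕ) : ℚ) * 2 = N * (N - 1) := by
    rcases N with _ | N
    · simp
    · rw [← Nat.cast_two, ← Nat.cast_mul, h2]; push_cast; simp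
  have h4 : ∑ i, shiftedPart N μ i = μ.card + ∑ i : Fin N, (N - 1 - (i : ℕ)) := by
    rw [card_eq_sum_rowLen hN, ← sum_add_distrib]; rfl
  rw [← Nat.cast_sum, h4, Nat.cast_add]
  linarith

/-- The formula of Frobenius for the number of standard Young tableaux. -/
theorem numSYT_eq_frobenius {n N : ℕ} {μ : YoungDiagram} (hμ : μ.card = n) (hN : μ.rowLen N = 0) :
    (numSYT μ : ℚ) = n.factorial * frobenius N μ := by
  induction n generalizing μ with
  | zero =>
    have : ∀ k, μ.rowLen k = 0 := fun k => rowLen_eq_zero_of_le (by omega)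
    rw [numSYT_of_card_eq_zero hμ, frobenius_of_rowLen_eq_zero this]
    simp
  | succ n ih =>
    classical
    have hsum : ∑ ν ∈ partitionsOf n with ν ≤ μ, frobenius N ν = ∑ i : Fin N, frobenius N μ *
        (shiftedPart N μ i * ∏ j ∈ univ.erase i,
          ((shiftedPart N μ i : ℚ) - 1 - shiftedPart N μ j) /
            ((shiftedPart N μ i : ℚ) - shiftedPart N μ j)) := by
      refine sum_below_eq_sum_rows hμ hN _ _ (fun ν i h => h.frobenius_left) fun i hi => ?_
      -- If no cell can be removed from row `i`, the two rows are equal. Then either `i` is the last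
      -- row and its shifted part is 0, or consecutive shifted parts differ by 1 and a factor of the
      -- product vanishes.
      have h1 : μ.rowLen i = μ.rowLen (i + 1) :=
        le_antisymm (not_lt.1 fun h => hi (exists_addsCell_left h))
          (μ.rowLen_anti _ _ (Nat.le_succ _))
      have hiN := i.2
      refine mul_eq_zero_of_right _ ?_
      by_cases hlast : (i : ℕ) + 1 = N
      · rw [hlast, hN] at h1
        have : shiftedPart N μ i = 0 := by unfold shiftedPart; omega
        rw [this]; simp
      · refine mul_eq_zero_of_right _ ?_
        have hlt : (i : ℕ) + 1 < N := by omega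
        refine prod_eq_zero (i := (⟨i + 1, hlt⟩ : Fin N))
          (mem_erase.2 ⟨fun h => by simpa using congrArg Fin.val h, mem_univ _⟩) ?_
        have : shiftedPart N μ i = shiftedPart N μ ⟨i + 1, hlt⟩ + 1 := by
          unfold shiftedPart
          simp only
          omega
        rw [this]; simp
    -- The weights sum to `μ.card = n + 1`, which is the factor between `n!` and `(n + 1)!`.
    rw [← mul_sum, sum_branching_weight _ _ (cast_shiftedPart_injective N μ).injOn,
      sum_shiftedPart hN, card_univ, Fintype.card_fin, add_sub_cancel_right] at hsum
    rw [numSYT_eq_sum hμ, Nat.cast_sum]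
    have hterm : ∀ ν ∈ (partitionsOf n).filter (· ≤ μ),
        (numSYT ν : ℚ) = n.factorial * frobenius N ν := by
      intro ν hν
      rw [mem_filter, mem_partitionsOf] at hν
      obtain ⟨i, hi⟩ := exists_addsCell hν.2 (by omega)
      refine ih hν.1 ?_
      have := hi N
      omega
    rw [sum_congr rfl hterm, ← mul_sum, hsum, hμ, Nat.factorial_succ]
    push_cast
    ring

/-! ### The generating polynomial: recurrence and closed form. -/

open Polynomial

/-- The polynomial `∏ (u + μ_i + N - i)` in `u`. -/
noncomputable def shiftedPoly (N : ℕ) (μ : YoungDiagram) : ℚ[X] :=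
  ∏ i, (X + C (shiftedPart N μ i : ℚ))

theorem AddsCell.shiftedPoly_right {ν μ : YoungDiagram} {N : ℕ} {i : Fin N} (h : AddsCell ν μ i) :
    shiftedPoly N μ = (X + C ((shiftedPart N ν i : ℚ) + 1)) *
      ∏ j ∈ univ.erase i, (X + C (shiftedPart N ν j : ℚ)) := by
  unfold shiftedPoly
  rw [← mul_prod_erase univ _ (mem_univ i), h.shiftedPart_eq i, if_pos rfl, Nat.cast_add,
    Nat.cast_one]
  congr 1
  refine prod_congr rfl fun k hk => ?_
  rw [h.shiftedPart_eq k, if_neg (mem_erase.1 hk).1, add_zero]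

theorem shiftedPart_castSucc {n : ℕ} (μ : YoungDiagram) (i : Fin n) :
    shiftedPart (n + 1) μ i.castSucc = shiftedPart n μ i + 1 := by
  have := i.2
  unfold shiftedPart
  simp only [Fin.val_castSucc]
  omega

theorem prod_erase_last {M : Type*} [CommMonoid M] {n : ℕ} (f : Fin (n + 1) → M) :
    ∏ j ∈ univ.erase (Fin.last n), f j = ∏ j : Fin n, f j.castSucc := by
  have : univ.erase (Fin.last n) = univ.map Fin.castSuccEmb := by
    ext j
    simp [Fin.exists_castSucc_eq]
  rw [this, prod_map]
  rfl

open Classical in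
theorem sum_above_numSYT_mul_shiftedPoly {n : ℕ} {ν : YoungDiagram} (hν : ν.card = n) :
    ∑ μ ∈ partitionsOf (n + 1) with ν ≤ μ, C (numSYT μ : ℚ) * shiftedPoly (n + 1) μ =
      C (((n : ℚ) + 1) * numSYT ν) *
        (X * (shiftedPoly n ν).comp (X + 1) + shiftedPoly n ν) := by
  -- With `n + 1` rows the last row of `ν` is empty and plays the role of `t` in
  -- `sum_growth_weight`; the other shifted parts exceed those for `n` rows by 1. Hence the shift `X
  -- + 1` in one term only.
  have hlast : shiftedPart (n + 1) ν (Fin.last n) = 0 := by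
    have := rowLen_eq_zero_of_le hν.le
    simp [shiftedPart, this]
  have hgrow := sum_growth_weight univ (fun i => (shiftedPart (n + 1) ν i : ℚ))
    (cast_shiftedPart_injective _ _).injOn (Fin.last n) (mem_univ _) (by simp [hlast])
    fun i _ => by positivity
  have hN : ν.rowLen (n + 1) = 0 := rowLen_eq_zero_of_le (by omega)
  have hsum : ∑ μ ∈ partitionsOf (n + 1) with ν ≤ μ,
      C (frobenius (n + 1) μ) * shiftedPoly (n + 1) μ = _ :=
    sum_above_eq_sum_rows hν _ (fun i => C (frobenius (n + 1) ν) *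
      (C ((∏ j ∈ univ.erase i, ((shiftedPart (n + 1) ν i : ℚ) + 1 - shiftedPart (n + 1) ν j) /
        ((shiftedPart (n + 1) ν i : ℚ) - shiftedPart (n + 1) ν j)) /
          (shiftedPart (n + 1) ν i + 1)) *
        ((X + C ((shiftedPart (n + 1) ν i : ℚ) + 1)) *
          ∏ j ∈ univ.erase i, (X + C (shiftedPart (n + 1) ν j : ℚ)))))
      (fun μ i h => by rw [h.frobenius_right, h.shiftedPoly_right, map_mul, mul_assoc])
      fun i hi => by
        -- A row that cannot be extended equals the row above it, whose shifted part is larger by 1,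
        -- so the weight has a zero factor.
        obtain ⟨k, hk, hlt⟩ : ∃ k, k + 1 = (i : ℕ) ∧ ν.rowLen k ≤ ν.rowLen i := by
          by_contra hcon
          push Not at hcon
          exact hi (exists_addsCell_right hcon)
        have hle := ν.rowLen_anti k i (by omega)
        have hi2 := i.2
        rw [prod_eq_zero (i := (⟨k, by omega⟩ : Fin (n + 1)))]
        · simp
        · exact mem_erase.2 ⟨fun h => by have := congrArg Fin.val h; simp at this; omega,
            mem_univ _⟩
        · have : shiftedPart (n + 1) ν ⟨k, by omega⟩ = shiftedPart (n + 1) ν i + 1 := by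
            unfold shiftedPart
            simp only
            omega
          rw [this]; simp
  rw [← mul_sum, hgrow] at hsum
  have hterm : ∀ μ ∈ (partitionsOf (n + 1)).filter (ν ≤ ·),
      C (numSYT μ : ℚ) * shiftedPoly (n + 1) μ = C ((n + 1).factorial : ℚ) *
        (C (frobenius (n + 1) μ) * shiftedPoly (n + 1) μ) := by
    intro μ hμ
    have hc := mem_partitionsOf.1 (mem_filter.1 hμ).1
    rw [numSYT_eq_frobenius hc (rowLen_eq_zero_of_le hc.le), map_mul, mul_assoc]
  rw [sum_congr rfl hterm, ← mul_sum, hsum, numSYT_eq_frobenius hν hN, ← mul_assoc, ← map_mul]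
  congr 1
  · rw [Nat.factorial_succ]; push_cast; ring_nf
  · rw [prod_erase_last, Fin.prod_univ_castSucc, hlast]
    simp only [shiftedPart_castSucc, shiftedPoly, Nat.cast_add, Nat.cast_one, add_sub_cancel_right,
      Polynomial.prod_comp, add_comp, X_comp, C_comp, Nat.cast_zero, map_zero, add_zero, map_add, map_one]
    rw [mul_comm]
    congr 2
    exact prod_congr rfl fun i _ => by ring

/-- The generating polynomial of the sums over all partitions of `n`. -/
noncomputable def totalPoly (n : ℕ) : ℚ[X] :=
  ∑ μ ∈ partitionsOf n, C ((numSYT μ : ℚ) ^ 2) * shiftedPoly n μ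

/-- One factor of `f_μ²` is expanded by the branching rule, and after exchanging the sums the other
is summed over the diagrams above `ν`. -/
theorem totalPoly_succ (n : ℕ) : totalPoly (n + 1) =
    C ((n : ℚ) + 1) * (X * (totalPoly n).comp (X + 1) + totalPoly n) := by
  classical
  have h1 : totalPoly (n + 1) = ∑ μ ∈ partitionsOf (n + 1), ∑ ν ∈ partitionsOf n with ν ≤ μ,
      C (numSYT ν : ℚ) * (C (numSYT μ : ℚ) * shiftedPoly (n + 1) μ) := by
    refine sum_congr rfl fun μ hμ => ?_
    rw [← sum_mul, ← map_sum, ← Nat.cast_sum, ← numSYT_eq_sum (mem_partitionsOf.1 hμ), sq, map_mul,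
      mul_assoc]
  rw [h1, sum_comm' (t' := partitionsOf n)
    (s' := fun ν => (partitionsOf (n + 1)).filter (ν ≤ ·))
    (fun μ ν => by simp only [mem_filter]; tauto)]
  have h2 : ∀ ν ∈ partitionsOf n, ∑ μ ∈ partitionsOf (n + 1) with ν ≤ μ,
      C (numSYT ν : ℚ) * (C (numSYT μ : ℚ) * shiftedPoly (n + 1) μ) = C ((n : ℚ) + 1) *
        (X * (C ((numSYT ν : ℚ) ^ 2) * (shiftedPoly n ν).comp (X + 1)) +
          C ((numSYT ν : ℚ) ^ 2) * shiftedPoly n ν) := by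
    intro ν hν
    rw [← mul_sum, sum_above_numSYT_mul_shiftedPoly (mem_partitionsOf.1 hν)]
    simp only [map_mul, map_pow]
    ring
  rw [sum_congr rfl h2, ← mul_sum, sum_add_distrib, ← mul_sum]
  simp only [totalPoly, Polynomial.sum_comp, mul_comp, C_comp]

theorem totalPoly_zero : totalPoly 0 = 1 := by
  have : partitionsOf 0 = {⊥} := by
    ext μ
    rw [mem_partitionsOf, mem_singleton]
    exact ⟨eq_bot_of_card_eq_zero, fun h => by rw [h]; rfl⟩
  rw [totalPoly, this, sum_singleton, numSYT_of_card_eq_zero rfl]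
  simp [shiftedPoly]

/-- Substituting `X + 1` and multiplying by `X` raises the index of a rising factorial by 1, so the
recurrence becomes Pascal's rule. -/
theorem totalPoly_eq (n : ℕ) : totalPoly n =
    C (n.factorial : ℚ) * ∑ α ∈ range (n + 1), C (n.choose α : ℚ) * ascPochhammer ℚ α := by
  induction n with
  | zero => simp [totalPoly_zero]
  | succ n ih =>
    have hcomp : X * (∑ α ∈ range (n + 1), C (n.choose α : ℚ) * ascPochhammer ℚ α).comp (X + 1) =
        ∑ α ∈ range (n + 1), C (n.choose α : ℚ) * ascPochhammer ℚ (α + 1) := by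
      rw [Polynomial.sum_comp, mul_sum]
      refine sum_congr rfl fun α _ => ?_
      rw [mul_comp, C_comp, ascPochhammer_succ_left]
      ring
    have hpas : ∑ α ∈ range (n + 2), C ((n + 1).choose α : ℚ) * ascPochhammer ℚ α =
        ∑ α ∈ range (n + 1), C (n.choose α : ℚ) * ascPochhammer ℚ (α + 1) +
        ∑ α ∈ range (n + 1), C (n.choose α : ℚ) * ascPochhammer ℚ α := by
      rw [sum_range_succ']
      have : ∑ α ∈ range (n + 1), C (n.choose α : ℚ) * ascPochhammer ℚ α =
          ∑ α ∈ range (n + 1), C (n.choose (α + 1) : ℚ) * ascPochhammer ℚ (α + 1) +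
            C (n.choose 0 : ℚ) * ascPochhammer ℚ 0 := by
        rw [← sum_range_succ' (fun α => C (n.choose α : ℚ) * ascPochhammer ℚ α),
          sum_range_succ _ (n + 1), Nat.choose_succ_self]
        simp
      rw [this, ← add_assoc, ← sum_add_distrib]
      congr 1
      · refine sum_congr rfl fun α _ => ?_
        rw [Nat.choose_succ_succ, Nat.cast_add, map_add, add_mul]
      · simp
    rw [totalPoly_succ, ih, mul_comp, C_comp, hpas, ← hcomp, Nat.factorial_succ]
    push_cast
    simp only [map_mul, map_add, map_one]
    ring

theorem coeff_ascPochhammer (m k : ℕ) :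
    (ascPochhammer ℚ m).coeff k = (Nat.stirlingFirst m k : ℚ) := by
  induction m generalizing k with
  | zero =>
    cases k with
    | zero => simp
    | succ k => simp [coeff_one]
  | succ m ih =>
    rw [ascPochhammer_succ_right, ← C_eq_natCast, mul_add, coeff_add, coeff_mul_C]
    cases k with
    | zero => cases m <;> simp [ih]
    | succ k =>
      rw [coeff_mul_X, ih, ih, Nat.stirlingFirst_succ_succ]
      push_cast
      ring

/-! ### Coefficients of the generating polynomial and Stirling numbers. -/

theorem shiftedParts_eq_map (n : ℕ) (μ : YoungDiagram) :
    shiftedParts n μ = (univ : Finset (Fin n)).val.map (shiftedPart n μ) := by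
  simp only [shiftedParts, Multiset.bind_def, Multiset.pure_def, Multiset.bind_singleton,
    Multiset.map_map]
  rfl

theorem coeff_shiftedPoly {n β : ℕ} (h : β ≤ n) (μ : YoungDiagram) :
    (shiftedPoly n μ).coeff (n - β) = ((shiftedParts n μ).esymm β : ℚ) := by
  rw [shiftedParts_eq_map, Finset.esymm_map_val, shiftedPoly,
    Finset.prod_X_add_C_coeff _ _ (by rw [card_univ, Fintype.card_fin]; omega), card_univ,
    Fintype.card_fin, Nat.sub_sub_self h]
  push_cast
  rfl

theorem shiftedSum_eq_coeff {n β : ℕ} (h : β ≤ n) :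
    shiftedSum n β = 1 / (n.factorial : ℚ) * (totalPoly n).coeff (n - β) := by
  rw [shiftedSum, totalPoly, finsetSum_coeff]
  congr 1
  refine sum_congr rfl fun μ _ => ?_
  rw [coeff_C_mul, coeff_shiftedPoly h]

theorem shiftedSum_eq_sum_stirlingFirst {n β : ℕ} (h : β ≤ n) :
    shiftedSum n β =
      ∑ α ∈ Icc (n - β) n, (Nat.stirlingFirst α (n - β) : ℚ) * (n.choose α : ℚ) := by
  have hn : (n.factorial : ℚ) ≠ 0 := Nat.cast_ne_zero.2 (Nat.factorial_ne_zero _)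
  rw [shiftedSum_eq_coeff h, totalPoly_eq, coeff_C_mul, ← mul_assoc, one_div_mul_cancel hn, one_mul,
    finsetSum_coeff]
  symm
  have hsub : Icc (n - β) n ⊆ range (n + 1) := fun α hα => by
    rw [mem_range]; have := (mem_Icc.1 hα).2; omega
  rw [← sum_subset hsub]
  · refine sum_congr rfl fun α _ => ?_
    rw [coeff_C_mul, coeff_ascPochhammer, mul_comm]
  · intro α hα hα'
    rw [mem_range] at hα
    rw [mem_Icc] at hα'
    rw [coeff_C_mul, coeff_ascPochhammer, Nat.stirlingFirst_eq_zero_of_lt (by omega)]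
    simp

theorem shiftedSum_eq_zero_of_lt {n β : ℕ} (h : n < β) : shiftedSum n β = 0 := by
  rw [shiftedSum, sum_eq_zero, mul_zero]
  intro μ _
  rw [shiftedParts_eq_map, Finset.esymm_map_val, powersetCard_eq_empty.2 (by simpa using h)]
  simp

/-! ### Polynomiality in `n`. -/

/-- The coefficient of `m.choose s` in the unsigned Stirling number `c(m, m - k)`. -/
def stirlingNewton : ℕ → ℕ → ℕ
  | 0, 0 => 1
  | 0, _ + 1 => 0
  | _ + 1, 0 => 0
  | k + 1, s + 1 => s * (stirlingNewton k s + stirlingNewton k (s - 1))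

theorem stirlingNewton_eq_zero_of_lt {k s : ℕ} (h : 2 * k < s) : stirlingNewton k s = 0 := by
  induction k generalizing s with
  | zero =>
    obtain ⟨t, rfl⟩ : ∃ t, s = t + 1 := ⟨s - 1, by omega⟩
    rfl
  | succ k ih =>
    obtain ⟨t, rfl⟩ : ∃ t, s = t + 1 := ⟨s - 1, by omega⟩
    rw [stirlingNewton, ih (by omega), ih (by omega), add_zero, mul_zero]

theorem stirlingNewton_pos (k : ℕ) : 0 < stirlingNewton k (2 * k) := by
  induction k with
  | zero => exact one_pos
  | succ k ih =>
    rw [show 2 * (k + 1) = 2 * k + 1 + 1 by ring, stirlingNewton, Nat.add_sub_cancel]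
    positivity

/-- The polynomial in `m` that agrees with `c(m, m - k)`, evaluated by its Newton expansion. -/
def stirlingCodiag (k m : ℕ) : ℕ :=
  ∑ s ∈ range (2 * k + 1), stirlingNewton k s * m.choose s

theorem mul_choose_eq (m s : ℕ) : m * m.choose s = s * m.choose s + (s + 1) * m.choose (s + 1) := by
  rcases le_or_gt s m with h | h
  · have := Nat.choose_succ_right_eq m s
    obtain ⟨d, rfl⟩ := Nat.exists_eq_add_of_le h
    rw [Nat.add_sub_cancel_left] at this
    linarith
  · rw [Nat.choose_eq_zero_of_lt h, Nat.choose_eq_zero_of_lt (by omega : m < s + 1)]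
    simp

/-- This is the Stirling recurrence along codiagonals. The recursion of `stirlingNewton` is made for
it: the difference of `m.choose (s + 1)` in `m` is `m.choose s`, and `mul_choose_eq` expands the
factor `m`. The truncated `s - 1` at `s = 0` is harmless, being multiplied by `s`. -/
theorem stirlingCodiag_succ_succ (k m : ℕ) :
    stirlingCodiag (k + 1) (m + 1) = stirlingCodiag (k + 1) m + m * stirlingCodiag k m := by
  have h1 : m * stirlingCodiag k m =
      ∑ s ∈ range (2 * k + 2), s * (stirlingNewton k s + stirlingNewton k (s - 1)) * m.choose s := by
    simp only [mul_add, add_mul, sum_add_distrib]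
    rw [sum_range_succ _ (2 * k + 1), sum_range_succ' _ (2 * k + 1),
      stirlingNewton_eq_zero_of_lt (by omega : 2 * k < 2 * k + 1)]
    simp only [mul_zero, zero_mul, add_zero, Nat.add_sub_cancel]
    rw [← sum_add_distrib, stirlingCodiag, mul_sum]
    refine sum_congr rfl fun s _ => ?_
    have := mul_choose_eq m s
    calc m * (stirlingNewton k s * m.choose s) = stirlingNewton k s * (m * m.choose s) := by ring
      _ = _ := by rw [this]; ring
  rw [h1, stirlingCodiag, stirlingCodiag, show 2 * (k + 1) + 1 = 2 * k + 2 + 1 by ring,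
    sum_range_succ', sum_range_succ' _ (2 * k + 2)]
  simp only [Nat.choose_succ_succ, mul_add, sum_add_distrib, stirlingNewton]
  simp only [add_mul, sum_add_distrib]
  ring

theorem stirlingCodiag_zero (m : ℕ) : stirlingCodiag 0 m = 1 := by
  simp [stirlingCodiag, stirlingNewton]

theorem stirlingCodiag_succ_zero (k : ℕ) : stirlingCodiag (k + 1) 0 = 0 := by
  refine sum_eq_zero fun s _ => ?_
  cases s <;> simp [stirlingNewton]

/-- The value 0 for `k > m` is what makes the final polynomial correct also for `n < β`. -/
theorem stirlingCodiag_eq (k m : ℕ) :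
    stirlingCodiag k m = if k ≤ m then Nat.stirlingFirst m (m - k) else 0 := by
  induction m generalizing k with
  | zero =>
    cases k with
    | zero => simp [stirlingCodiag_zero]
    | succ k => simp [stirlingCodiag_succ_zero]
  | succ m ih =>
    cases k with
    | zero => simp [stirlingCodiag_zero, Nat.stirlingFirst_self]
    | succ k =>
      rw [stirlingCodiag_succ_succ, ih, ih]
      rcases lt_trichotomy k m with h | rfl | h
      · obtain ⟨d, rfl⟩ := Nat.exists_eq_add_of_lt h
        rw [if_pos (by omega), if_pos (by omega), if_pos (by omega),
          show k + d + 1 + 1 - (k + 1) = d + 1 by omega, Nat.stirlingFirst_succ_succ,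
          show k + d + 1 - (k + 1) = d by omega, show k + d + 1 - k = d + 1 by omega]
        ring
      · rw [if_neg (by omega), if_pos le_rfl, if_pos le_rfl, Nat.sub_self, Nat.sub_self]
        cases k <;> simp
      · rw [if_neg (by omega), if_neg (by omega), if_neg (by omega)]
        simp

theorem shiftedSum_eq_sum_stirlingCodiag (n β : ℕ) :
    shiftedSum n β =
      ∑ j ∈ range (β + 1), (n.choose j : ℚ) * (stirlingCodiag (β - j) (n - j) : ℚ) := by
  rcases le_or_gt β n with h | h
  · rw [shiftedSum_eq_sum_stirlingFirst h]
    refine sum_bij (fun α _ => n - α) (fun α hα => ?_) (fun α hα α' hα' h => ?_)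
      (fun j hj => ?_) (fun α hα => ?_)
    · rw [mem_Icc] at hα
      rw [mem_range]; omega
    · rw [mem_Icc] at hα hα'
      omega
    · rw [mem_range] at hj
      exact ⟨n - j, by rw [mem_Icc]; omega, by omega⟩
    · rw [mem_Icc] at hα
      rw [stirlingCodiag_eq, if_pos (by omega), Nat.choose_symm hα.2, mul_comm, Nat.sub_sub_self hα.2,
        show α - (β - (n - α)) = n - β by omega]
  · rw [shiftedSum_eq_zero_of_lt h]
    symm
    refine sum_eq_zero fun j hj => ?_
    rcases le_or_gt j n with hjn | hjn
    · rw [stirlingCodiag_eq, if_neg (by omega)]; simp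
    · rw [Nat.choose_eq_zero_of_lt hjn]; simp

theorem exists_polynomial_shiftedSum (β : ℕ) :
    ∃ P : ℚ[X], P.degree = ((2 * β : ℕ) : WithBot ℕ) ∧
      ∀ n : ℕ, P.eval (n : ℚ) = shiftedSum n β := by
  -- From `n.choose j * (n - j).choose s = n.choose (j + s) * (j + s).choose j`, with `n.choose (j +
  -- s)` written as a falling factorial over `(j + s)!`.
  let g : ℕ → ℕ → ℚ := fun j s => (stirlingNewton (β - j) s * (j + s).choose j : ℚ) /
    ((j + s).factorial : ℚ)
  have hg : ∀ j s, 0 ≤ g j s := fun j s => by positivity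
  have hdeg : ∀ d, (descPochhammer ℚ d).natDegree = d := fun d => descPochhammer_natDegree ℚ d
  have hcoeff : ∀ j ∈ range (β + 1), ∀ s ∈ range (2 * (β - j) + 1),
      0 ≤ (C (g j s) * descPochhammer ℚ (j + s)).coeff (2 * β) := by
    intro j hj s hs
    rw [mem_range] at hj hs
    rw [coeff_C_mul]
    refine mul_nonneg (hg j s) ?_
    rcases (show j + s ≤ 2 * β by omega).eq_or_lt with h | h
    · have := monic_descPochhammer ℚ (j + s)
      rw [Monic, leadingCoeff, hdeg] at this
      rw [← h, this]
      exact zero_le_one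
    · rw [coeff_eq_zero_of_natDegree_lt (by rwa [hdeg])]
  refine ⟨∑ j ∈ range (β + 1), ∑ s ∈ range (2 * (β - j) + 1),
    C (g j s) * descPochhammer ℚ (j + s), ?_, fun n => ?_⟩
  · refine degree_eq_of_le_of_coeff_ne_zero ?_ (ne_of_gt ?_)
    · refine degree_le_of_natDegree_le ?_
      refine natDegree_sum_le_of_forall_le _ _ fun j hj =>
        natDegree_sum_le_of_forall_le _ _ fun s hs => ?_
      rw [mem_range] at hj hs
      refine (natDegree_C_mul_le _ _).trans ?_
      rw [hdeg]
      omega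
    -- No cancellation can occur in degree `2 * β`, since all contributions are nonnegative; the
    -- term `j = 0`, `s = 2 * β` is positive.
    · simp only [finsetSum_coeff]
      refine sum_pos' (fun j hj => sum_nonneg (hcoeff j hj)) ⟨0, mem_range.2 (by omega), ?_⟩
      refine sum_pos' (hcoeff 0 (mem_range.2 (by omega)))
        ⟨2 * β, mem_range.2 (by omega), ?_⟩
      have hm := monic_descPochhammer ℚ (0 + 2 * β)
      rw [Monic, leadingCoeff, hdeg, zero_add] at hm
      rw [coeff_C_mul, zero_add, hm, mul_one]
      have := stirlingNewton_pos β
      simp only [g, Nat.sub_zero, zero_add, Nat.choose_zero_right, Nat.cast_one, mul_one]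
      positivity
  · rw [shiftedSum_eq_sum_stirlingCodiag, eval_finsetSum]
    refine sum_congr rfl fun j _ => ?_
    rw [eval_finsetSum, stirlingCodiag, Nat.cast_sum, mul_sum]
    refine sum_congr rfl fun s _ => ?_
    have hf : ((j + s).factorial : ℚ) ≠ 0 := Nat.cast_ne_zero.2 (Nat.factorial_ne_zero _)
    rw [eval_mul, eval_C, descPochhammer_eval_eq_descFactorial,
      Nat.descFactorial_eq_factorial_mul_choose]
    have hch : (n.choose (j + s) * (j + s).choose j : ℚ) = n.choose j * (n - j).choose s := by
      have := Nat.choose_mul (n := n) (k := j + s) (s := j) (by omega)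
      rw [Nat.add_sub_cancel_left] at this
      exact_mod_cast this
    simp only [g]
    push_cast
    rw [div_mul_eq_mul_div, div_eq_iff hf]
    linear_combination (stirlingNewton (β - j) s * (j + s).factorial : ℚ) * hch

/-! ### The multilinear coefficient of the generating series. -/

theorem sum_single_eq_iff_bijective {α γ : Type*} [Fintype α] [Fintype γ] (f : α → γ) :
    ∑ a, Finsupp.single (f a) 1 = ∑ v : γ, Finsupp.single v (1 : ℕ) ↔ Function.Bijective f := by
  classical
  have h1 : ∀ w, (∑ v : γ, Finsupp.single v (1 : ℕ)) w = 1 := fun w => by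
    simp [Finsupp.finsetSum_apply, Finsupp.single_apply]
  have h2 : ∀ w, (∑ a, Finsupp.single (f a) (1 : ℕ)) w = #{a | f a = w} := fun w => by
    simp [Finsupp.finsetSum_apply, Finsupp.single_apply]
  rw [Finsupp.ext_iff, Function.bijective_iff_existsUnique]
  refine forall_congr' fun w => ?_
  rw [h1, h2, card_eq_one, singleton_iff_unique_mem]
  simp

theorem coeff_prod_X {R α γ : Type*} [CommSemiring R] [Fintype α] [Fintype γ] (f : α → γ)
    [Decidable (Function.Bijective f)] :
    (∏ a, MvPolynomial.X (f a) : MvPolynomial γ R).coeff (∑ v : γ, Finsupp.single v 1) =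
      if Function.Bijective f then 1 else 0 := by
  classical
  have : (∏ a, MvPolynomial.X (f a) : MvPolynomial γ R) =
      MvPolynomial.monomial (∑ a, Finsupp.single (f a) 1) 1 := by
    rw [MvPolynomial.monomial_sum_one]
    rfl
  rw [this, MvPolynomial.coeff_monomial]
  simp only [sum_single_eq_iff_bijective]

/-- Fillings of `μ` that form a semistandard Young tableau. -/
def IsSemistandard {n : ℕ} {μ : YoungDiagram} (T : μ.cells → Fin n) : Prop :=
  ∃ S : SemistandardYoungTableau μ, ∀ c : μ.cells, S c.1.1 c.1.2 = (T c : ℕ)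

open Classical in
theorem isSemistandard_of_increasing {n : ℕ} {μ : YoungDiagram} (T : μ.cells → Fin n)
    (h1 : ∀ c d : μ.cells, c.1.1 = d.1.1 → c.1.2 < d.1.2 → T c < T d)
    (h2 : ∀ c d : μ.cells, c.1.2 = d.1.2 → c.1.1 < d.1.1 → T c < T d) : IsSemistandard T := by
  let E : ℕ → ℕ → ℕ := fun i j => if h : (i, j) ∈ μ.cells then (T ⟨(i, j), h⟩ : ℕ) else 0
  have hE : ∀ i j (h : (i, j) ∈ μ.cells), E i j = T ⟨(i, j), h⟩ := fun i j h => dif_pos h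
  refine ⟨⟨E, fun {i j1 j2} hj hm => ?_, fun {i1 i2 j} hi hm => ?_, fun hm => dif_neg hm⟩,
    fun c => hE _ _ c.2⟩
  · have hm' : (i, j1) ∈ μ := μ.up_left_mem le_rfl hj.le hm
    rw [hE _ _ hm, hE _ _ hm']
    exact (h1 ⟨_, hm'⟩ ⟨_, hm⟩ rfl hj).le
  · have hm' : (i1, j) ∈ μ := μ.up_left_mem hi.le le_rfl hm
    rw [hE _ _ hm, hE _ _ hm']
    exact h2 ⟨_, hm'⟩ ⟨_, hm⟩ rfl hi

-- A bijective filling has no repeated entries, so weak increase along rows is already strict, and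
-- semistandard means standard.
open Classical in
theorem card_bijective_semistandard (n : ℕ) (μ : YoungDiagram) :
    #{T : μ.cells → Fin n | IsSemistandard T ∧ Function.Bijective T} =
      if μ.card = n then numSYT μ else 0 := by
  split_ifs with h
  · subst h
    rw [numSYT, ← Fintype.card_subtype, ← Nat.card_eq_fintype_card]
    symm
    refine Nat.card_eq_of_bijective (fun T => ⟨T.1, isSemistandard_of_increasing _ T.2.1 T.2.2,
      T.1.bijective⟩) ⟨fun T T' h => ?_, ?_⟩
    · exact Subtype.ext (DFunLike.coe_injective (congrArg Subtype.val h))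
    · rintro ⟨T, ⟨S, hS⟩, hT⟩
      refine ⟨⟨Equiv.ofBijective T hT, fun c d e h => ?_, fun c d e h => ?_⟩, rfl⟩
      · refine lt_of_le_of_ne (Fin.le_def.2 ?_) fun h' => ?_
        · change (T c : ℕ) ≤ T d
          rw [← hS, ← hS, e]
          exact S.row_weak h d.2
        · have := hT.1 h'
          subst this
          exact lt_irrefl _ h
      · change (T c : ℕ) < T d
        rw [← hS, ← hS, e]
        exact S.col_strict h d.2
  · rw [card_eq_zero, filter_eq_empty_iff]
    rintro T - ⟨-, hT⟩
    exact h (by simpa [YoungDiagram.card] using Fintype.card_of_bijective hT)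

open Classical in
theorem coeff_schurTerm (n : ℕ) (μ : YoungDiagram) :
    (schurTerm n μ).coeff (∑ v : Fin n ⊕ Fin n, Finsupp.single v 1) =
      if μ.card = n then Polynomial.C ((numSYT μ : ℚ) ^ 2) * shiftedPoly n μ else 0 := by
  have hpoly : ((shiftedParts n μ).map fun a => (a : Polynomial ℚ) + Polynomial.X).prod =
      shiftedPoly n μ := by
    simp only [shiftedParts_eq_map, Multiset.bind_def, Multiset.pure_def,
      Multiset.bind_singleton, Multiset.map_map]
    rw [shiftedPoly, Finset.prod]
    congr 1
    refine Multiset.map_congr rfl fun i _ => ?_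
    simp [add_comm]
  have hren : ∀ g : Fin n → Fin n ⊕ Fin n,
      MvPolynomial.rename g (schurPoly (Polynomial ℚ) n μ) =
        ∑ T : μ.cells → Fin n with IsSemistandard T, ∏ c, MvPolynomial.X (g (T c)) := by
    intro g
    rw [schurPoly, map_sum]
    refine sum_congr rfl fun T _ => ?_
    rw [map_prod]
    simp only [MvPolynomial.rename_X]
  have hterm : ∀ T T' : μ.cells → Fin n,
      ((∏ c, MvPolynomial.X (Sum.inl (T c))) * ∏ c, MvPolynomial.X (Sum.inr (T' c)) :
        MvPolynomial (Fin n ⊕ Fin n) (Polynomial ℚ)).coeff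
          (∑ v : Fin n ⊕ Fin n, Finsupp.single v 1) =
      (if Function.Bijective T then 1 else 0) * if Function.Bijective T' then 1 else 0 := by
    intro T T'
    -- A pair of fillings is a single map between disjoint unions, bijective exactly when both
    -- fillings are.
    have h := coeff_prod_X (R := Polynomial ℚ) (Sum.map T T')
    rw [Fintype.prod_sum_type] at h
    simp only [Sum.map_inl, Sum.map_inr, Sum.map_bijective] at h
    rw [h, ite_and, ite_mul, one_mul, zero_mul]
  rw [schurTerm, hpoly, mul_comm, MvPolynomial.coeff_C_mul, hren, hren, sum_mul_sum, MvPolynomial.coeff_sum]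
  simp only [MvPolynomial.coeff_sum, hterm]
  rw [← sum_mul_sum, ← sq, sum_boole, filter_filter, card_bijective_semistandard]
  split_ifs
  · rw [mul_comm, map_pow]; simp
  · simp

theorem colLen_zero_le_card (μ : YoungDiagram) : μ.colLen 0 ≤ μ.card := by
  rw [YoungDiagram.colLen_eq_card]
  exact card_le_card (filter_subset _ _)

theorem genCoeff_eq_coeff (n k : ℕ) : genCoeff n k = (totalPoly n).coeff k := by
  classical
  rw [genCoeff]
  congr 1
  change ∑ᶠ (μ : YoungDiagram) (_ : μ.colLen 0 ≤ n),
    (schurTerm n μ).coeff (∑ v : Fin n ⊕ Fin n, Finsupp.single v 1) = _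
  rw [finsum_eq_sum_of_support_subset (s := partitionsOf n), totalPoly]
  · refine sum_congr rfl fun μ hμ => ?_
    rw [mem_partitionsOf] at hμ
    rw [finsum_eq_if, if_pos (hμ ▸ colLen_zero_le_card μ), coeff_schurTerm, if_pos hμ]
  · intro μ hμ
    rw [mem_coe, mem_partitionsOf]
    by_contra hne
    refine hμ ?_
    simp only [coeff_schurTerm, if_neg hne, finsum_zero]

end ShiftedParts

theorem corollary4p2 (β : ℕ) :
    (∀ n : ℕ, β ≤ n →
      1 / (n.factorial : ℚ) * ShiftedParts.genCoeff n (n - β) = ShiftedParts.shiftedSum n β ∧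
      ShiftedParts.shiftedSum n β =
        ∑ α ∈ Finset.Icc (n - β) n, (Nat.stirlingFirst α (n - β) : ℚ) * (n.choose α : ℚ)) ∧
    ∃ P : Polynomial ℚ, P.degree = ((2 * β : ℕ) : WithBot ℕ) ∧
      ∀ n : ℕ, P.eval (n : ℚ) = ShiftedParts.shiftedSum n β :=
  ⟨fun n h => ⟨by rw [ShiftedParts.shiftedSum_eq_coeff h, ShiftedParts.genCoeff_eq_coeff],
    ShiftedParts.shiftedSum_eq_sum_stirlingFirst h⟩, ShiftedParts.exists_polynomial_shiftedSum β⟩
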